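/- Throughout, a sequence $\mathbb{M}=(M_p)_{p\in\mathbb{N}_0}$ is a sequence of positive real numbers with $M_0=1$; its quotients are $m_p=M_{p+1}/M_p$. It is log-convex if $M_p^2\le M_{p-1}M_{p+1}$ for all $p\ge 1$. Two sequences are equivalent, $\mathbb{L}\approx\mathbb{M}$, if there are $C,D>0$ with $D^pM_p\le L_p\le C^pM_p$ for all $p\in\mathbb{N}_0$. For log-convex $\mathbb{M}$ with $m_p\to\infty$ put $M(t)=\sup_{p\in\mathbb{N}_0}\log(t^p/M_p)$ for $t>0$, and $d_{\mathbb{M}}(t)=\log(M(t))/\log(t)$ for $t$ large enough. A nonzero proximate order is a real function $\rho$ on some interval $(c,\infty)$, $c\ge 0$, such that: (A) $\rho$ is continuous, and it is continuously differentiable except possibly at points forming a finite set or a sequence tending to infinity, at each of which it has distinct finite lateral derivatives; (B) $\rho(r)\ge 0$ for all $r>c$; (C) $\lim_{r\to\infty}\rho(r)$ exists, is finite and is positive; (D) $\lim_{r\to\infty}r\rho'(r)\log(r)=0$, the limit being taken through the points where $\rho$ is differentiable. A function defined for all large $t$, such as $d_{\mathbb{M}}$, is called a nonzero proximate order if its restriction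 to some $(c,\infty)$ is one. Theorem. Let $\mathbb{M}$ be log-convex with $\lim_{p\to\infty}m_p=\infty$. The following are equivalent: (e) There exists a log-convex sequence $\mathbb{L}$, with quotients tending to infinity, such that $\mathbb{L}\approx\mathbb{M}$ and $d_{\mathbb{L}}$ is a nonzero proximate order. (f) $\mathbb{M}$ admits a nonzero proximate order, i.e. there exist a nonzero proximate order $\rho$ and constants $A,B\in\mathbb{R}$ such that $A\le \log(t)\,(\rho(t)-d_{\mathbb{M}}(t))\le B$ for all $t$ large enough. -/

import Mathlib

open Filter Topology Set

noncomputable section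

/-- Normalized sequences of positive real numbers: `M 0 = 1` and `M p > 0` for every `p`. -/
structure IsNormalizedPosSeq (M : ℕ → ℝ) : Prop where
  pos : ∀ p, 0 < M p
  zero : M 0 = 1

/-- Logarithmic convexity: `M_p ^ 2 ≤ M_{p-1} M_{p+1}` for every `p ≥ 1` (with the index shifted
by one). -/
def IsLogConvex (M : ℕ → ℝ) : Prop :=
  ∀ p : ℕ, M (p + 1) ^ 2 ≤ M p * M (p + 2)

/-- The sequence of quotients `m_p = M_{p+1} / M_p`. -/
def quotients (M : ℕ → ℝ) (p : ℕ) : ℝ :=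
  M (p + 1) / M p

/-- Equivalence of sequences: `D ^ p * L p ≤ M p ≤ C ^ p * L p` for some `C, D > 0`. -/
def SeqEquiv (M L : ℕ → ℝ) : Prop :=
  ∃ C D : ℝ, 0 < C ∧ 0 < D ∧ ∀ p : ℕ, D ^ p * L p ≤ M p ∧ M p ≤ C ^ p * L p

/-- The associated function `M(t) = sup_p log (t ^ p / M_p)`, `t > 0`. For a log-convex sequence
whose quotients tend to infinity the supremum is finite for every `t > 0`. -/
def assocFun (M : ℕ → ℝ) (t : ℝ) : ℝ :=
  ⨆ p : ℕ, Real.log (t ^ p / M p)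

/-- The function `d_M(t) = log (M(t)) / log t`, meaningful for `t` large enough. -/
def dFun (M : ℕ → ℝ) (t : ℝ) : ℝ :=
  Real.log (assocFun M t) / Real.log t

/-- `ρ` is continuous and piecewise continuously differentiable in `(c, ∞)`: it is continuous, and
continuously differentiable off a set `S` of exceptional points, of which only finitely many lie
below any given bound (so `S` is empty, finite, or the range of a sequence tending to infinity), and
at each of which `ρ` has distinct finite lateral derivatives. -/
def IsPiecewiseC1 (ρ : ℝ → ℝ) (c : ℝ) : Prop :=
  ContinuousOn ρ (Ioi c) ∧
    ∃ S : Set ℝ, S ⊆ Ioi c ∧ (∀ b : ℝ, (S ∩ Iic b).Finite) ∧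
      (∀ r ∈ Ioi c \ S, DifferentiableAt ℝ ρ r) ∧
      ContinuousOn (deriv ρ) (Ioi c \ S) ∧
      ∀ s ∈ S, ∃ a b : ℝ, a ≠ b ∧
        HasDerivWithinAt ρ a (Iio s) s ∧ HasDerivWithinAt ρ b (Ioi s) s

/-- The function `ρ`, restricted to `(c, ∞)`, is a proximate order with limit `l` at infinity.
In the last condition the limit is taken through the points at which `ρ` is differentiable. -/
structure IsProximateOrderOn (ρ : ℝ → ℝ) (c l : ℝ) : Prop where
  c_nonneg : 0 ≤ c
  piecewiseC1 : IsPiecewiseC1 ρ c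
  nonneg : ∀ r, c < r → 0 ≤ ρ r
  tendsto : Tendsto ρ atTop (𝓝 l)
  tendsto_deriv : Tendsto (fun r => r * deriv ρ r * Real.log r)
    (atTop ⊓ 𝓟 {r | DifferentiableAt ℝ ρ r}) (𝓝 0)

/-- `ρ` is, on some half-line `(c, ∞)`, a proximate order whose limit at infinity is positive. -/
def IsNonzeroProximateOrder (ρ : ℝ → ℝ) : Prop :=
  ∃ c l : ℝ, 0 < l ∧ IsProximateOrderOn ρ c l

/-- `M` admits a nonzero proximate order: for some nonzero proximate order `ρ` and constants
`A`, `B` one has `A ≤ log t * (ρ t - d_M t) ≤ B` for `t` large enough. -/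
def AdmitsNonzeroProximateOrder (M : ℕ → ℝ) : Prop :=
  ∃ ρ : ℝ → ℝ, IsNonzeroProximateOrder ρ ∧
    ∃ A B : ℝ, ∀ᶠ t in atTop,
      A ≤ Real.log t * (ρ t - dFun M t) ∧ Real.log t * (ρ t - dFun M t) ≤ B

end

noncomputable section

/-! Everything happens on the logarithmic scale. For a proximate order ρ with limit l > 0, put f(x)
= x ρ(e^x); at r = e^x its derivative is ρ(r) + r ρ'(r) log r, which tends to l. So f has slope l at
infinity (`IsProximateOrderOn.hasSlopeAtTop`): a translation of x changes f boundedly, and a long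
enough translation beats any constant. Since log t · d_M(t) = log M(t), admitting ρ means that log
M(e^x) - f(x) is bounded.

If L ≈ M, the associated functions are comparable up to dilations of t, that is, translations of x.
When d_L is a proximate order these cost only bounded terms, so ρ = d_L works for M.

Conversely, given ρ, choose L with log-quotients a_p solving f(a_p) = log(p+1)
(`HasSlopeAtTop.exists_seq`). Then (p+1)(a_{p+1} - a_p) → 1/l, and a Cesàro argument gives
M_L(t)/n(t) → 1/l, where n(t) counts the quotients below t (`tendsto_assocFun_div_quotientCount`).
Hence log M_L - f ∘ log is bounded and d_L → l. Off the quotients t d_L'(t) log t = n(t)/M_L(t) -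
d_L(t) → l - l = 0, so d_L is a proximate order. Both log M_M and log M_L are within bounded
distance of f ∘ log, and the positive slope turns this into dilations, hence into L ≈ M. -/

/-! ### Associated function, counting function of the quotients, and comparison of sequences. -/

theorem quotients_pos {M : ℕ → ℝ} (hM : IsNormalizedPosSeq M) (p : ℕ) : 0 < quotients M p :=
  div_pos (hM.pos _) (hM.pos _)

theorem log_quotients {M : ℕ → ℝ} (hM : IsNormalizedPosSeq M) (p : ℕ) :
    Real.log (quotients M p) = Real.log (M (p + 1)) - Real.log (M p) :=
  Real.log_div (hM.pos _).ne' (hM.pos _).ne'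

theorem monotone_quotients {M : ℕ → ℝ} (hM : IsNormalizedPosSeq M) (hlc : IsLogConvex M) :
    Monotone (quotients M) := by
  refine monotone_nat_of_le_succ fun p => ?_
  unfold quotients
  rw [div_le_div_iff₀ (hM.pos _) (hM.pos _)]
  nlinarith [hlc p]

theorem log_pow_div {M : ℕ → ℝ} (hM : IsNormalizedPosSeq M) {t : ℝ} (ht : 0 < t) (p : ℕ) :
    Real.log (t ^ p / M p) = p * Real.log t - Real.log (M p) := by
  rw [Real.log_div (pow_pos ht p).ne' (hM.pos p).ne', Real.log_pow]

/-- The supremum defining the associated function is attained at `n` when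
`m_{n-1} ≤ t ≤ m_n`. -/
theorem isGreatest_log_pow_div {M : ℕ → ℝ} (hM : IsNormalizedPosSeq M) (hlc : IsLogConvex M)
    {t : ℝ} (ht : 0 < t) {n : ℕ} (h₁ : ∀ j < n, quotients M j ≤ t) (h₂ : t ≤ quotients M n) :
    IsGreatest (range fun p : ℕ => Real.log (t ^ p / M p)) (n * Real.log t - Real.log (M n)) := by
  refine ⟨⟨n, log_pow_div hM ht n⟩, ?_⟩
  rintro _ ⟨p, rfl⟩
  simp only [log_pow_div hM ht]
  rcases le_total p n with hp | hp
  · induction hp using Nat.decreasingInduction with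
    | self => exact le_rfl
    | of_succ k hk ih =>
      have := Real.log_le_log (quotients_pos hM k) (h₁ k hk)
      rw [log_quotients hM] at this
      push_cast at ih
      linarith
  · induction p, hp using Nat.le_induction with
    | base => exact le_rfl
    | succ k hk ih =>
      have := Real.log_le_log ht (h₂.trans (monotone_quotients hM hlc hk))
      rw [log_quotients hM] at this
      push_cast
      linarith

theorem assocFun_eq {M : ℕ → ℝ} (hM : IsNormalizedPosSeq M) (hlc : IsLogConvex M)
    {t : ℝ} (ht : 0 < t) {n : ℕ} (h₁ : ∀ j < n, quotients M j ≤ t) (h₂ : t ≤ quotients M n) :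
    assocFun M t = n * Real.log t - Real.log (M n) :=
  (isGreatest_log_pow_div hM hlc ht h₁ h₂).csSup_eq

/-- The number of quotients of `M` (assumed nondecreasing) that are smaller than `t`. -/
def quotientCount (M : ℕ → ℝ) (t : ℝ) : ℕ :=
  sInf {p | t ≤ quotients M p}

theorem le_quotients_quotientCount {M : ℕ → ℝ} (hm : Tendsto (quotients M) atTop atTop) (t : ℝ) :
    t ≤ quotients M (quotientCount M t) :=
  Nat.sInf_mem (s := {p | t ≤ quotients M p}) (hm.eventually_ge_atTop t).exists

theorem quotients_lt_of_lt_quotientCount {M : ℕ → ℝ} {t : ℝ} {p : ℕ}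
    (h : p < quotientCount M t) : quotients M p < t :=
  not_le.1 fun h' => Nat.notMem_of_lt_sInf h h'

theorem lt_quotientCount {M : ℕ → ℝ} (hM : IsNormalizedPosSeq M) (hlc : IsLogConvex M)
    (hm : Tendsto (quotients M) atTop atTop) {t : ℝ} {p : ℕ} (h : quotients M p < t) :
    p < quotientCount M t :=
  (monotone_quotients hM hlc).reflect_lt (h.trans_le (le_quotients_quotientCount hm t))

theorem tendsto_quotientCount {M : ℕ → ℝ} (hM : IsNormalizedPosSeq M) (hlc : IsLogConvex M)
    (hm : Tendsto (quotients M) atTop atTop) : Tendsto (quotientCount M) atTop atTop := by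
  refine tendsto_atTop.2 fun p => ?_
  filter_upwards [eventually_gt_atTop (quotients M p)] with t ht
  exact (lt_quotientCount hM hlc hm ht).le

theorem assocFun_eq_quotientCount {M : ℕ → ℝ} (hM : IsNormalizedPosSeq M) (hlc : IsLogConvex M)
    (hm : Tendsto (quotients M) atTop atTop) {t : ℝ} (ht : 0 < t) :
    assocFun M t = quotientCount M t * Real.log t - Real.log (M (quotientCount M t)) :=
  assocFun_eq hM hlc ht (fun _ hj => (quotients_lt_of_lt_quotientCount hj).le)
    (le_quotients_quotientCount hm t)

theorem le_assocFun {M : ℕ → ℝ} (hM : IsNormalizedPosSeq M) (hlc : IsLogConvex M)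
    (hm : Tendsto (quotients M) atTop atTop) {t : ℝ} (ht : 0 < t) (p : ℕ) :
    p * Real.log t - Real.log (M p) ≤ assocFun M t := by
  rw [← log_pow_div hM ht]
  exact le_ciSup (f := fun p : ℕ => Real.log (t ^ p / M p))
    (isGreatest_log_pow_div hM hlc ht
      (fun _ hj => (quotients_lt_of_lt_quotientCount hj).le)
      (le_quotients_quotientCount hm t)).isLUB.bddAbove p

theorem tendsto_assocFun {M : ℕ → ℝ} (hM : IsNormalizedPosSeq M) (hlc : IsLogConvex M)
    (hm : Tendsto (quotients M) atTop atTop) : Tendsto (assocFun M) atTop atTop := by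
  have h := tendsto_atTop_add_const_right atTop (-Real.log (M 1)) Real.tendsto_log_atTop
  refine tendsto_atTop_mono' _ ?_ h
  filter_upwards [eventually_gt_atTop 0] with t ht
  have := le_assocFun hM hlc hm ht 1
  simp only [Nat.cast_one, one_mul] at this
  linarith

/-- A bound `A_p ≤ C ^ p B_p` gives the reverse comparison of associated functions. -/
theorem assocFun_le_of_le_pow_mul {A B : ℕ → ℝ} (hA : IsNormalizedPosSeq A)
    (hB : IsNormalizedPosSeq B) (hlc : IsLogConvex A) (hm : Tendsto (quotients A) atTop atTop)
    {C : ℝ} (hC : 0 < C) (h : ∀ p, A p ≤ C ^ p * B p) {t : ℝ} (ht : 0 < t) :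
    assocFun B t ≤ assocFun A (C * t) := by
  refine ciSup_le fun p => ?_
  rw [log_pow_div hB ht]
  have h₁ := le_assocFun hA hlc hm (mul_pos hC ht) p
  have h₂ := Real.log_le_log (hA.pos p) (h p)
  rw [Real.log_mul (pow_pos hC p).ne' (hB.pos p).ne', Real.log_pow] at h₂
  rw [Real.log_mul hC.ne' ht.ne'] at h₁
  linarith

/-- A comparison of associated functions for large arguments gives one of sequences. -/
theorem exists_le_pow_mul_of_assocFun_le {A B : ℕ → ℝ} (hA : IsNormalizedPosSeq A)
    (hB : IsNormalizedPosSeq B) (hlcA : IsLogConvex A) (hlcB : IsLogConvex B)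
    (hmA : Tendsto (quotients A) atTop atTop) (hmB : Tendsto (quotients B) atTop atTop)
    {C : ℝ} (hC : 0 < C) (h : ∀ᶠ t in atTop, assocFun A t ≤ assocFun B (C * t)) :
    ∃ K : ℝ, 0 < K ∧ ∀ p, B p ≤ K ^ p * A p := by
  have hev : ∀ᶠ p in atTop, B p ≤ C ^ p * A p := by
    -- Evaluate at t = m_p / C, where m_p are the quotients of B: at Ct = m_p the supremum for B is
    -- attained at index p + 1, hence the shift of p by one.
    have h₁ := (hmB.atTop_div_const hC).eventually h
    rw [← map_add_atTop_eq_nat 1, eventually_map]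
    filter_upwards [h₁] with p hp
    have hq := quotients_pos hB p
    rw [mul_div_cancel₀ _ hC.ne', assocFun_eq hB hlcB hq (n := p + 1)
      (fun j hj => monotone_quotients hB hlcB (by lia))
      (monotone_quotients hB hlcB (by lia))] at hp
    have h₂ := (le_assocFun hA hlcA hmA (div_pos hq hC) (p + 1)).trans hp
    rw [Real.log_div hq.ne' hC.ne'] at h₂
    refine (Real.log_le_log_iff (hB.pos _) (mul_pos (pow_pos hC _) (hA.pos _))).1 ?_
    rw [Real.log_mul (pow_pos hC _).ne' (hA.pos _).ne', Real.log_pow]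
    linarith
  obtain ⟨N, hN⟩ := eventually_atTop.1 hev
  have hr : ∀ q, 0 ≤ B q / A q := fun q => (div_pos (hB.pos q) (hA.pos q)).le
  have hs : 0 ≤ ∑ q ∈ Finset.range N, B q / A q := Finset.sum_nonneg fun q _ => hr q
  -- This constant dominates C, 1 and each of the finitely many ratios B q / A q with q < N; index 0
  -- needs the normalization instead.
  refine ⟨C + 1 + ∑ q ∈ Finset.range N, B q / A q, by linarith, fun p => ?_⟩
  set K := C + 1 + ∑ q ∈ Finset.range N, B q / A q
  rcases le_or_gt N p with hp | hp
  · refine (hN p hp).trans (mul_le_mul_of_nonneg_right ?_ (hA.pos p).le)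
    exact pow_le_pow_left₀ hC.le (by linarith) p
  · rcases Nat.eq_zero_or_pos p with rfl | hp0
    · simp [hA.zero, hB.zero]
    · rw [← div_le_iff₀ (hA.pos p)]
      have h₁ := Finset.single_le_sum (f := fun q => B q / A q) (fun q _ => hr q)
        (Finset.mem_range.2 hp)
      have h₂ : K ≤ K ^ p := le_self_pow₀ (by linarith) hp0.ne'
      linarith

/-! ### Functions with a slope at infinity. -/

/-- The difference quotients of `f` between large points are close to `l`. -/
def HasSlopeAtTop (f : ℝ → ℝ) (l : ℝ) : Prop :=
  ∀ ε > 0, ∃ x₀, ∀ x y, x₀ ≤ x → x ≤ y → |f y - f x - l * (y - x)| ≤ ε * (y - x)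

/-- A mean value inequality with a finite set of exceptional points. -/
theorem abs_sub_sub_mul_le_of_finite {f f' : ℝ → ℝ} {l ε : ℝ} (F : Finset ℝ) :
    ∀ {x y : ℝ}, x ≤ y → ContinuousOn f (Icc x y) →
      (∀ z ∈ Ioo x y, z ∉ F → HasDerivAt f (f' z) z ∧ |f' z - l| ≤ ε) →
      |f y - f x - l * (y - x)| ≤ ε * (y - x) := by
  induction F using Finset.induction_on with
  | empty =>
    intro x y hxy hc hd
    rcases hxy.eq_or_lt with rfl | hlt
    · simp
    obtain ⟨z, hz, hz'⟩ := exists_hasDerivAt_eq_slope f f' hlt hc fun z hz => (hd z hz (by simp)).1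
    have h := (hd z hz (by simp)).2
    have hpos : 0 < y - x := sub_pos.2 hlt
    have : f y - f x = f' z * (y - x) := by rw [hz', div_mul_cancel₀ _ hpos.ne']
    rw [this, ← sub_mul, abs_mul, abs_of_pos hpos]
    exact mul_le_mul_of_nonneg_right h hpos.le
  | insert s F hs ih =>
    intro x y hxy hc hd
    by_cases hmem : s ∈ Ioo x y
    · have h₁ := ih hmem.1.le (hc.mono (Icc_subset_Icc_right hmem.2.le)) fun z hz hzF =>
        hd z ⟨hz.1, hz.2.trans hmem.2⟩ (by simp [hzF, hz.2.ne])
      have h₂ := ih hmem.2.le (hc.mono (Icc_subset_Icc_left hmem.1.le)) fun z hz hzF =>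
        hd z ⟨hmem.1.trans hz.1, hz.2⟩ (by simp [hzF, hz.1.ne'])
      rw [abs_le] at h₁ h₂ ⊢
      constructor <;> linarith [h₁.1, h₁.2, h₂.1, h₂.2]
    · refine ih hxy hc fun z hz hzF => hd z hz ?_
      have : z ≠ s := fun h => hmem (h ▸ hz)
      simp [hzF, this]

/-- With r = e^x the derivative is ρ(r) + r ρ'(r) log r, where the first term tends to l and the
second to 0. Only finitely many exceptional points lie below e^y, so the mean value inequality
applies on [x, y]. -/
theorem IsProximateOrderOn.hasSlopeAtTop {ρ : ℝ → ℝ} {c l : ℝ} (h : IsProximateOrderOn ρ c l) :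
    HasSlopeAtTop (fun x => x * ρ (Real.exp x)) l := by
  intro ε hε
  obtain ⟨hcont, S, -, hfin, hdiff, -, -⟩ := h.piecewiseC1
  have h₁ : ∀ᶠ r in atTop, |ρ r - l| ≤ ε / 2 := by
    have := h.tendsto.eventually (Metric.closedBall_mem_nhds l (half_pos hε))
    simpa [Real.dist_eq] using this
  have h₂ : ∀ᶠ r in atTop, DifferentiableAt ℝ ρ r → |r * deriv ρ r * Real.log r| ≤ ε / 2 := by
    have := h.tendsto_deriv.eventually (Metric.closedBall_mem_nhds 0 (half_pos hε))
    rw [eventually_inf_principal] at this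
    simpa [Real.dist_eq] using this
  obtain ⟨r₀, hr₀⟩ := eventually_atTop.1 ((h₁.and h₂).and (eventually_gt_atTop c))
  obtain ⟨x₀, hx₀⟩ := eventually_atTop.1 (Real.tendsto_exp_atTop.eventually_ge_atTop r₀)
  refine ⟨x₀, fun x y hx hxy => ?_⟩
  have hbig : ∀ z, x ≤ z → r₀ ≤ Real.exp z := fun z hz => hx₀ z (hx.trans hz)
  refine abs_sub_sub_mul_le_of_finite (f := fun x => x * ρ (Real.exp x))
    (f' := fun z => 1 * ρ (Real.exp z) + z * (deriv ρ (Real.exp z) * Real.exp z))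
    ((hfin (Real.exp y)).image Real.log).toFinset hxy ?_ ?_
  · refine continuousOn_id.mul (hcont.comp Real.continuous_exp.continuousOn fun z hz => ?_)
    exact (hr₀ _ (hbig z hz.1)).2
  · intro z hz hzF
    have hb := hr₀ _ (hbig z hz.1.le)
    have hzS : Real.exp z ∉ S := fun hmem => hzF <| by
      simp only [Finite.mem_toFinset]
      exact ⟨_, ⟨hmem, Real.exp_le_exp.2 hz.2.le⟩, Real.log_exp z⟩
    have hd := hdiff _ ⟨hb.2, hzS⟩
    refine ⟨(hasDerivAt_id z).mul (hd.hasDerivAt.comp z (Real.hasDerivAt_exp z)), ?_⟩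
    have h₃ := hb.1.2 hd
    have h₄ := hb.1.1
    rw [Real.log_exp] at h₃
    rw [abs_le] at h₃ h₄ ⊢
    constructor <;> linarith [h₃.1, h₃.2, h₄.1, h₄.2]

theorem HasSlopeAtTop.continuousOn {f : ℝ → ℝ} {l : ℝ} (h : HasSlopeAtTop f l) :
    ∃ x₀, ContinuousOn f (Ici x₀) := by
  obtain ⟨x₀, hx₀⟩ := h 1 one_pos
  refine ⟨x₀, LipschitzOnWith.continuousOn (K := (|l| + 1).toNNReal) ?_⟩
  refine LipschitzOnWith.of_le_add_mul _ fun x hx y hy => ?_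
  rw [Real.coe_toNNReal _ (by positivity), Real.dist_eq]
  rcases le_total x y with hxy | hxy
  · have := abs_le.1 (hx₀ x y hx hxy)
    rw [abs_of_nonpos (sub_nonpos.2 hxy)]
    nlinarith [neg_abs_le l, this.1, this.2, sub_nonneg.2 hxy]
  · have := abs_le.1 (hx₀ y x hy hxy)
    rw [abs_of_nonneg (sub_nonneg.2 hxy)]
    nlinarith [le_abs_self l, this.1, this.2, sub_nonneg.2 hxy]

/-- Far out f grows at rate at least l/2, so a translation absorbs any additive constant. This
converts bounded errors in log M(t) into dilations of t. -/
theorem HasSlopeAtTop.exists_gap {f : ℝ → ℝ} {l : ℝ} (h : HasSlopeAtTop f l) (hl : 0 < l)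
    (K : ℝ) : ∃ c, 0 < c ∧ ∀ᶠ x in atTop, f x + K ≤ f (x + c) := by
  obtain ⟨x₀, hx₀⟩ := h (l / 2) (half_pos hl)
  refine ⟨2 * |K| / l + 1, by positivity, ?_⟩
  filter_upwards [eventually_ge_atTop x₀] with x hx
  set c := 2 * |K| / l + 1
  have hc : 0 < c := by positivity
  have := (abs_le.1 (hx₀ x (x + c) hx (by linarith))).1
  have h₁ : l / 2 * c = |K| + l / 2 := by simp only [c]; field_simp
  have := le_abs_self K
  have h₂ : x + c - x = c := by ring
  rw [h₂] at *
  linarith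

theorem HasSlopeAtTop.exists_bound {f : ℝ → ℝ} {l : ℝ} (h : HasSlopeAtTop f l) (c : ℝ) :
    ∃ K, ∀ᶠ x in atTop, |f (x + c) - f x| ≤ K := by
  obtain ⟨x₀, hx₀⟩ := h 1 one_pos
  refine ⟨|l * c| + |c|, ?_⟩
  filter_upwards [eventually_ge_atTop (x₀ + |c|)] with x hx
  rcases le_total 0 c with hc | hc
  · rw [abs_of_nonneg hc] at *
    have := abs_le.1 (hx₀ x (x + c) (by linarith) (by linarith))
    have h₁ := abs_le.1 (le_refl |l * c|)
    rw [add_sub_cancel_left] at this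
    rw [abs_le]
    constructor <;> linarith [this.1, this.2, h₁.1, h₁.2]
  · rw [abs_of_nonpos hc] at *
    have := abs_le.1 (hx₀ (x + c) x (by linarith) (by linarith))
    have h₁ := abs_le.1 (le_refl |l * c|)
    rw [show x - (x + c) = -c by ring] at this
    rw [abs_le]
    constructor <;> linarith [this.1, this.2, h₁.1, h₁.2]

/-- Points at which `f` takes the values `log (p + 1)` for large `p`. -/
theorem HasSlopeAtTop.exists_seq {f : ℝ → ℝ} {l : ℝ} (h : HasSlopeAtTop f l) (hl : 0 < l) :
    ∃ a : ℕ → ℝ, Monotone a ∧ Tendsto a atTop atTop ∧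
      (∀ᶠ p in atTop, f (a p) = Real.log ((p : ℝ) + 1)) ∧
      (∀ᶠ p in atTop, a p < a (p + 1)) ∧
      Tendsto (fun p : ℕ => ((p : ℝ) + 1) * (a (p + 1) - a p)) atTop (𝓝 (1 / l)) := by
  obtain ⟨x₁, hx₁⟩ := h (l / 2) (half_pos hl)
  obtain ⟨x₂, hx₂⟩ := h.continuousOn
  set x₀ := max x₁ x₂
  -- Beyond x₀ the slopes of f lie between l/2 and 3l/2: the lower bound gives strict monotonicity
  -- and divergence of f, the upper one divergence of a.
  have hlow : ∀ x y, x₀ ≤ x → x ≤ y → l / 2 * (y - x) ≤ f y - f x := fun x y hx hxy => by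
    linarith [(abs_le.1 (hx₁ x y ((le_max_left _ _).trans hx) hxy)).1]
  have hupp : ∀ x y, x₀ ≤ x → x ≤ y → f y - f x ≤ 3 * l / 2 * (y - x) := fun x y hx hxy => by
    linarith [(abs_le.1 (hx₁ x y ((le_max_left _ _).trans hx) hxy)).2]
  have hsm : StrictMonoOn f (Ici x₀) := fun x hx y _ hxy => by
    have := hlow x y hx hxy.le
    have := mul_pos (half_pos hl) (sub_pos.2 hxy)
    linarith
  have hf : Tendsto f atTop atTop := by
    have h₁ : Tendsto (fun y => l / 2 * y + (f x₀ - l / 2 * x₀)) atTop atTop :=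
      tendsto_atTop_add_const_right _ _ (tendsto_id.const_mul_atTop (half_pos hl))
    refine tendsto_atTop_mono' _ ?_ h₁
    filter_upwards [eventually_ge_atTop x₀] with y hy
    linarith [hlow x₀ y le_rfl hy]
  have hlog : Tendsto (fun p : ℕ => Real.log ((p : ℝ) + 1)) atTop atTop :=
    Real.tendsto_log_atTop.comp (tendsto_atTop_add_const_right _ _ tendsto_natCast_atTop_atTop)
  obtain ⟨P, hP⟩ := (hlog.eventually_ge_atTop (f x₀)).exists
  have hlm : ∀ p q : ℕ, p ≤ q → Real.log ((p : ℝ) + 1) ≤ Real.log ((q : ℝ) + 1) := fun p q hpq =>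
    Real.log_le_log (by positivity) (by exact_mod_cast Nat.succ_le_succ hpq)
  -- For small p the value log(p+1) may lie below f(x₀); replacing p by max p P makes a constant up
  -- to P and keeps it monotone.
  have hex : ∀ p : ℕ, ∃ y, x₀ ≤ y ∧ f y = Real.log (((max p P : ℕ) : ℝ) + 1) := by
    intro p
    obtain ⟨z, hz, hz'⟩ := ((hf.eventually_ge_atTop
      (Real.log (((max p P : ℕ) : ℝ) + 1))).and (eventually_ge_atTop x₀)).exists
    obtain ⟨y, hy, hy'⟩ := intermediate_value_Icc hz'
      (hx₂.mono fun u hu => (le_max_right x₁ x₂).trans hu.1)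
      ⟨hP.trans (hlm _ _ (le_max_right p P)), hz⟩
    exact ⟨y, hy.1, hy'⟩
  choose a ha ha' using hex
  have hmono : Monotone a := fun p q hpq =>
    (hsm.le_iff_le (ha p) (ha q)).1 <| by
      rw [ha', ha']
      exact hlm _ _ (max_le_max hpq le_rfl)
  have hval : ∀ᶠ p in atTop, f (a p) = Real.log ((p : ℝ) + 1) := by
    filter_upwards [eventually_ge_atTop P] with p hp
    rw [ha', max_eq_left hp]
  have hval' : ∀ᶠ p in atTop, f (a (p + 1)) = Real.log (((p + 1 : ℕ) : ℝ) + 1) :=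
    (tendsto_add_atTop_nat 1).eventually hval
  have hlt : ∀ᶠ p in atTop, a p < a (p + 1) := by
    filter_upwards [hval, hval'] with p h₁ h₂
    refine (hsm.lt_iff_lt (ha p) (ha (p + 1))).1 ?_
    rw [h₁, h₂]
    exact Real.log_lt_log (by positivity) (by push_cast; linarith)
  have htop : Tendsto a atTop atTop := by
    have h₁ : Tendsto (fun p : ℕ => (Real.log ((p : ℝ) + 1) - f x₀) / (3 * l / 2)) atTop atTop :=
      (tendsto_atTop_add_const_right _ _ hlog).atTop_div_const (by positivity)
    refine tendsto_atTop_mono' _ ?_ (tendsto_atTop_add_const_right _ x₀ h₁)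
    filter_upwards [hval] with p hp
    have := hupp x₀ (a p) le_rfl (ha p)
    rw [hp, mul_comm, ← div_le_iff₀ (by positivity)] at this
    linarith
  refine ⟨a, hmono, htop, hval, hlt, ?_⟩
  have hslope : Tendsto (fun p => (f (a (p + 1)) - f (a p)) / (a (p + 1) - a p)) atTop (𝓝 l) := by
    refine Metric.tendsto_nhds.2 fun ε hε => ?_
    obtain ⟨x₃, hx₃⟩ := h (ε / 2) (half_pos hε)
    filter_upwards [hlt, htop.eventually_ge_atTop x₃] with p hp hp'
    have hpos := sub_pos.2 hp
    have h₁ := hx₃ _ _ hp' hp.le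
    rw [Real.dist_eq, show (f (a (p + 1)) - f (a p)) / (a (p + 1) - a p) - l =
      (f (a (p + 1)) - f (a p) - l * (a (p + 1) - a p)) / (a (p + 1) - a p) by field_simp,
      abs_div, abs_of_pos hpos, div_lt_iff₀ hpos]
    nlinarith
  have hone : Tendsto (fun p : ℕ => ((p : ℝ) + 1) * Real.log (1 + 1 / ((p : ℝ) + 1)))
      atTop (𝓝 1) :=
    (Real.tendsto_mul_log_one_add_div_atTop 1).comp
      (tendsto_atTop_add_const_right _ _ tendsto_natCast_atTop_atTop)
  refine (hone.div hslope hl.ne').congr' ?_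
  filter_upwards [hval, hval', hlt] with p h₁ h₂ h₃
  have hpos := sub_pos.2 h₃
  have hp : (0 : ℝ) < (p : ℝ) + 1 := by positivity
  have h₄ : f (a (p + 1)) - f (a p) = Real.log (1 + 1 / ((p : ℝ) + 1)) := by
    rw [h₁, h₂, ← Real.log_div (by positivity) hp.ne']
    congr 1
    push_cast
    field_simp
  have h₅ : 0 < Real.log (1 + 1 / ((p : ℝ) + 1)) := Real.log_pos (by
    have : 0 < 1 / ((p : ℝ) + 1) := by positivity
    linarith)
  simp only [Pi.div_apply]
  rw [h₄]
  generalize Real.log (1 + 1 / ((p : ℝ) + 1)) = w at h₅ ⊢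
  field_simp

/-! ### Cesàro asymptotics of the associated function. -/

/-- If `p log (m_p / m_{p-1})` converges, then so does `M(t)` divided by the number of quotients
below `t`, to the same limit. -/
theorem tendsto_assocFun_div_quotientCount {M : ℕ → ℝ} (hM : IsNormalizedPosSeq M)
    (hlc : IsLogConvex M) (hm : Tendsto (quotients M) atTop atTop) {κ : ℝ}
    (h : Tendsto (fun p : ℕ => ((p : ℝ) + 1) *
      (Real.log (quotients M (p + 1)) - Real.log (quotients M p))) atTop (𝓝 κ)) :
    Tendsto (fun t => assocFun M t / quotientCount M t) atTop (𝓝 κ) := by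
  set a : ℕ → ℝ := fun p => Real.log (quotients M p) with ha
  -- Abel summation: n a_n - log M_n is the sum over k < n of (k+1)(a_{k+1} - a_k), so this is a
  -- Cesàro mean.
  have hb : Tendsto (fun n : ℕ => (n : ℝ)⁻¹ * (n * a n - Real.log (M n))) atTop (𝓝 κ) := by
    refine h.cesaro.congr fun n => ?_
    congr 1
    induction n with
    | zero => simp [hM.zero]
    | succ k ih =>
      rw [Finset.sum_range_succ, ih]
      have := log_quotients hM k
      simp only [ha] at *
      push_cast
      linarith
  have hd : Tendsto (fun p : ℕ => a (p + 1) - a p) atTop (𝓝 0) := by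
    have h₀ : Tendsto (fun p : ℕ => 1 / ((p : ℝ) + 1)) atTop (𝓝 0) :=
      tendsto_one_div_add_atTop_nhds_zero_nat
    have := h₀.mul h
    rw [zero_mul] at this
    refine this.congr fun p => ?_
    have : (0 : ℝ) < (p : ℝ) + 1 := by positivity
    simp only [ha]
    field_simp
  have hd' : Tendsto (fun n : ℕ => a n - a (n - 1)) atTop (𝓝 0) := by
    rw [← tendsto_add_atTop_iff_nat 1]
    simpa using hd
  have hc := tendsto_quotientCount hM hlc hm
  have hlow := (hb.sub hd').comp hc
  rw [sub_zero] at hlow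
  -- With n = n(t), M(t)/n = log t - log(M_n)/n, and a_{n-1} ≤ log t ≤ a_n; the gap a_n - a_{n-1}
  -- vanishes in the limit.
  refine tendsto_of_tendsto_of_tendsto_of_le_of_le' hlow (hb.comp hc) ?_ ?_
  all_goals
    filter_upwards [eventually_gt_atTop 0, hc.eventually_ge_atTop 1] with t ht hn
    have h₁ := Real.log_le_log (quotients_pos hM _)
      (quotients_lt_of_lt_quotientCount (M := M) (t := t) (Nat.sub_lt hn one_pos)).le
    have h₂ := Real.log_le_log ht (le_quotients_quotientCount hm t)
    have hn' : (0 : ℝ) < quotientCount M t := by exact_mod_cast hn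
    simp only [Function.comp, ha]
    rw [assocFun_eq_quotientCount hM hlc hm ht]
    generalize quotientCount M t = n at *
    rw [sub_div, mul_sub, ← mul_assoc, inv_mul_cancel₀ hn'.ne', mul_div_assoc, mul_comm (n : ℝ),
      div_mul_cancel₀ _ hn'.ne', one_mul, inv_mul_eq_div]
    linarith

/-! ### Piecewise smoothness and derivative of d_M. -/

theorem dFun_mul_log (M : ℕ → ℝ) {t : ℝ} (ht : 1 < t) :
    Real.log t * dFun M t = Real.log (assocFun M t) :=
  mul_div_cancel₀ _ (Real.log_pos ht).ne'

/-- The expression of `dFun` on an interval between consecutive quotients. -/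
def dBranch (M : ℕ → ℝ) (n : ℕ) (t : ℝ) : ℝ :=
  Real.log (n * Real.log t - Real.log (M n)) / Real.log t

/-- The derivative of `dBranch`. -/
def dBranchDeriv (M : ℕ → ℝ) (n : ℕ) (t : ℝ) : ℝ :=
  (n / (n * Real.log t - Real.log (M n)) - dBranch M n t) / (t * Real.log t)

theorem hasDerivAt_dBranch {M : ℕ → ℝ} {n : ℕ} {t : ℝ} (ht : 1 < t)
    (hG : n * Real.log t - Real.log (M n) ≠ 0) :
    HasDerivAt (dBranch M n) (dBranchDeriv M n t) t := by
  have ht0 : t ≠ 0 := by positivity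
  have hl := (Real.log_pos ht).ne'
  have h₁ := Real.hasDerivAt_log ht0
  have h₂ := (((h₁.const_mul (n : ℝ)).sub_const (Real.log (M n))).log hG).div h₁ hl
  refine h₂.congr_deriv ?_
  unfold dBranchDeriv dBranch
  field_simp

theorem continuousAt_dBranchDeriv {M : ℕ → ℝ} {n : ℕ} {t : ℝ} (ht : 1 < t)
    (hG : n * Real.log t - Real.log (M n) ≠ 0) : ContinuousAt (dBranchDeriv M n) t := by
  have ht0 : t ≠ 0 := by positivity
  have hl := (Real.log_pos ht).ne'
  have h₁ := Real.continuousAt_log ht0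
  refine ((continuousAt_const.div ((continuousAt_const.mul h₁).sub continuousAt_const) hG).sub
    (hasDerivAt_dBranch ht hG).continuousAt).div (continuousAt_id.mul h₁) (mul_ne_zero ht0 hl)

theorem dFun_eq_dBranch {M : ℕ → ℝ} (hM : IsNormalizedPosSeq M) (hlc : IsLogConvex M)
    {t : ℝ} (ht : 0 < t) {n : ℕ} (h₁ : ∀ j < n, quotients M j ≤ t) (h₂ : t ≤ quotients M n) :
    dFun M t = dBranch M n t := by
  rw [dFun, dBranch, assocFun_eq hM hlc ht h₁ h₂]

theorem dFun_eqOn {M : ℕ → ℝ} (hM : IsNormalizedPosSeq M) (hlc : IsLogConvex M) (k : ℕ) :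
    EqOn (dFun M) (dBranch M (k + 1)) (Icc (quotients M k) (quotients M (k + 1))) := fun _ ht =>
  dFun_eq_dBranch hM hlc ((quotients_pos hM k).trans_le ht.1)
    (fun _ hj => (monotone_quotients hM hlc (Nat.lt_succ_iff.1 hj)).trans ht.1) ht.2

theorem hasDerivWithinAt_dFun_left {M : ℕ → ℝ} (hM : IsNormalizedPosSeq M) (hlc : IsLogConvex M)
    {k : ℕ} {t : ℝ} (h₁ : quotients M k < t) (h₂ : t ≤ quotients M (k + 1)) (ht : 1 < t)
    (hG : 0 < assocFun M t) :
    HasDerivWithinAt (dFun M) (dBranchDeriv M (k + 1) t) (Iio t) t := by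
  rw [assocFun_eq hM hlc (by linarith) (n := k + 1)
    (fun j hj => (monotone_quotients hM hlc (Nat.lt_succ_iff.1 hj)).trans h₁.le) h₂] at hG
  refine (hasDerivAt_dBranch ht hG.ne').hasDerivWithinAt.congr_of_eventuallyEq ?_
    (dFun_eqOn hM hlc k ⟨h₁.le, h₂⟩)
  filter_upwards [self_mem_nhdsWithin, mem_nhdsWithin_of_mem_nhds (Ioi_mem_nhds h₁)] with u hu hu'
  exact dFun_eqOn hM hlc k ⟨le_of_lt hu', (le_of_lt hu).trans h₂⟩

theorem hasDerivWithinAt_dFun_right {M : ℕ → ℝ} (hM : IsNormalizedPosSeq M) (hlc : IsLogConvex M)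
    {k : ℕ} {t : ℝ} (h₁ : quotients M k ≤ t) (h₂ : t < quotients M (k + 1)) (ht : 1 < t)
    (hG : 0 < assocFun M t) :
    HasDerivWithinAt (dFun M) (dBranchDeriv M (k + 1) t) (Ioi t) t := by
  rw [assocFun_eq hM hlc (by linarith) (n := k + 1)
    (fun j hj => (monotone_quotients hM hlc (Nat.lt_succ_iff.1 hj)).trans h₁) h₂.le] at hG
  refine (hasDerivAt_dBranch ht hG.ne').hasDerivWithinAt.congr_of_eventuallyEq ?_
    (dFun_eqOn hM hlc k ⟨h₁, h₂.le⟩)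
  filter_upwards [self_mem_nhdsWithin, mem_nhdsWithin_of_mem_nhds (Iio_mem_nhds h₂)] with u hu hu'
  exact dFun_eqOn hM hlc k ⟨h₁.trans (le_of_lt hu), le_of_lt hu'⟩

theorem dFun_eventuallyEq {M : ℕ → ℝ} (hM : IsNormalizedPosSeq M) (hlc : IsLogConvex M)
    {k : ℕ} {t : ℝ} (h₁ : quotients M k < t) (h₂ : t < quotients M (k + 1)) :
    dFun M =ᶠ[𝓝 t] dBranch M (k + 1) := by
  filter_upwards [Ioo_mem_nhds h₁ h₂] with u hu
  exact dFun_eqOn hM hlc k ⟨hu.1.le, hu.2.le⟩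

/-- Both branches have the same value at the quotient; in the derivative only the numerator of
n/M(t) jumps, from k to k + 1. -/
theorem dBranchDeriv_ne_of_consecutive {M : ℕ → ℝ} (hM : IsNormalizedPosSeq M)
    (hlc : IsLogConvex M) {k : ℕ} (ht : 1 < quotients M k) (hG : 0 < assocFun M (quotients M k)) :
    dBranchDeriv M k (quotients M k) ≠ dBranchDeriv M (k + 1) (quotients M k) := by
  have hmono := monotone_quotients hM hlc
  set t := quotients M k
  have e₁ := assocFun_eq hM hlc (t := t) (by linarith) (n := k) (fun j hj => hmono hj.le) le_rfl
  have e₂ := assocFun_eq hM hlc (t := t) (by linarith) (n := k + 1)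
    (fun j hj => hmono (Nat.lt_succ_iff.1 hj)) (hmono k.le_succ)
  unfold dBranchDeriv dBranch
  rw [← e₁, ← e₂]
  intro h
  have hpos : t * Real.log t ≠ 0 := mul_ne_zero (by linarith) (Real.log_pos ht).ne'
  rw [div_left_inj' hpos, sub_left_inj, div_left_inj' hG.ne'] at h
  push_cast at h
  linarith

theorem isPiecewiseC1_dFun {M : ℕ → ℝ} (hM : IsNormalizedPosSeq M) (hlc : IsLogConvex M)
    (hm : Tendsto (quotients M) atTop atTop) {c : ℝ} {P : ℕ} (hc : quotients M P ≤ c)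
    (hlt : ∀ p, P ≤ p → quotients M p < quotients M (p + 1))
    (hpos : ∀ t, c < t → 1 < t ∧ 0 < assocFun M t) : IsPiecewiseC1 (dFun M) c := by
  have hmono := monotone_quotients hM hlc
  have key : ∀ t, c < t → ∃ k, P ≤ k ∧ quotients M k < t ∧ t ≤ quotients M (k + 1) := by
    intro t ht
    have hn := lt_quotientCount hM hlc hm (hc.trans_lt ht)
    obtain ⟨k, hk⟩ := Nat.exists_eq_succ_of_ne_zero (Nat.ne_zero_of_lt hn)
    refine ⟨k, by lia, quotients_lt_of_lt_quotientCount (by lia), ?_⟩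
    have := le_quotients_quotientCount hm t
    rwa [hk] at this
  have hG : ∀ t, c < t → ∀ k, quotients M k < t → t ≤ quotients M (k + 1) →
      ((k + 1 : ℕ) : ℝ) * Real.log t - Real.log (M (k + 1)) ≠ 0 := fun t ht k h₁ h₂ => by
    rw [← assocFun_eq hM hlc (by linarith [(hpos t ht).1]) (n := k + 1)
      (fun j hj => (hmono (Nat.lt_succ_iff.1 hj)).trans h₁.le) h₂]
    exact (hpos t ht).2.ne'
  have hone : ∀ t, c < t → ∃ k, P ≤ k ∧ quotients M k < t ∧ (t < quotients M (k + 1) ∨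
      (t = quotients M (k + 1) ∧
        HasDerivWithinAt (dFun M) (dBranchDeriv M (k + 1) t) (Iio t) t ∧
        HasDerivWithinAt (dFun M) (dBranchDeriv M (k + 1 + 1) t) (Ioi t) t)) := by
    intro t ht
    obtain ⟨k, hk, h₁, h₂⟩ := key t ht
    refine ⟨k, hk, h₁, h₂.lt_or_eq.imp_right fun h => ⟨h, ?_, ?_⟩⟩
    · exact hasDerivWithinAt_dFun_left hM hlc h₁ h₂ (hpos t ht).1 (hpos t ht).2
    · exact hasDerivWithinAt_dFun_right hM hlc h.ge (h ▸ hlt (k + 1) (by lia))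
        (hpos t ht).1 (hpos t ht).2
  have hreg : ∀ t ∈ Ioi c \ (range (quotients M) ∩ Ioi c),
      ∃ k, quotients M k < t ∧ t < quotients M (k + 1) := by
    rintro t ⟨ht, hts⟩
    obtain ⟨k, -, h₁, h₂ | h₂⟩ := hone t ht
    · exact ⟨k, h₁, h₂⟩
    · exact absurd ⟨⟨k + 1, h₂.1.symm⟩, ht⟩ hts
  refine ⟨fun t ht => ?_, range (quotients M) ∩ Ioi c, inter_subset_right, fun b => ?_,
    fun t ht => ?_, fun t ht => ?_, ?_⟩
  · obtain ⟨k, -, h₁, h₂ | ⟨-, h₂, h₃⟩⟩ := hone t ht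
    · exact ((hasDerivAt_dBranch (hpos t ht).1 (hG t ht k h₁ h₂.le)).congr_of_eventuallyEq
        (dFun_eventuallyEq hM hlc h₁ h₂)).continuousAt.continuousWithinAt
    · exact (continuousAt_iff_continuous_left'_right'.2
        ⟨h₂.continuousWithinAt, h₃.continuousWithinAt⟩).continuousWithinAt
  · obtain ⟨N, hN⟩ := eventually_atTop.1 (hm.eventually_gt_atTop b)
    refine ((Set.finite_Iio N).image (quotients M)).subset ?_
    rintro _ ⟨⟨⟨p, rfl⟩, -⟩, hp⟩
    exact ⟨p, not_le.1 fun h => absurd hp (not_le.2 (hN p h)), rfl⟩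
  · obtain ⟨k, h₁, h₂⟩ := hreg t ht
    exact ((hasDerivAt_dBranch (hpos t ht.1).1 (hG t ht.1 k h₁ h₂.le)).congr_of_eventuallyEq
      (dFun_eventuallyEq hM hlc h₁ h₂)).differentiableAt
  · obtain ⟨k, h₁, h₂⟩ := hreg t ht
    refine ((continuousAt_dBranchDeriv (hpos t ht.1).1
      (hG t ht.1 k h₁ h₂.le)).congr ?_).continuousWithinAt
    filter_upwards [Ioo_mem_nhds h₁ h₂, Ioi_mem_nhds ht.1] with u hu hu'
    exact (((hasDerivAt_dBranch (hpos u hu').1 (hG u hu' k hu.1 hu.2.le)).congr_of_eventuallyEq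
      (dFun_eventuallyEq hM hlc hu.1 hu.2)).deriv).symm
  · rintro s ⟨⟨p, hp⟩, hs⟩
    obtain ⟨k, hk, h₁, h₂ | ⟨h₀, h₂, h₃⟩⟩ := hone s hs
    · subst hp
      have := hmono.reflect_lt h₁
      have := hmono.reflect_lt h₂
      lia
    · refine ⟨_, _, ?_, h₂, h₃⟩
      have := hpos s hs
      rw [h₀] at this ⊢
      exact dBranchDeriv_ne_of_consecutive hM hlc this.1 this.2

/-- The derivative condition rests on t d'(t) log t = n(t)/M(t) - d(t), both terms tending to l.
Eventual strictness of the quotients makes every large quotient a genuine corner. -/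
theorem isNonzeroProximateOrder_dFun {M : ℕ → ℝ} (hM : IsNormalizedPosSeq M) (hlc : IsLogConvex M)
    (hm : Tendsto (quotients M) atTop atTop) {l : ℝ} (hl : 0 < l)
    (hlt : ∀ᶠ p in atTop, quotients M p < quotients M (p + 1))
    (hd : Tendsto (dFun M) atTop (𝓝 l))
    (hn : Tendsto (fun t => assocFun M t / quotientCount M t) atTop (𝓝 (1 / l))) :
    IsNonzeroProximateOrder (dFun M) := by
  obtain ⟨P, hP⟩ := eventually_atTop.1 hlt
  obtain ⟨c₀, hc₀⟩ := eventually_atTop.1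
    ((eventually_gt_atTop 1).and ((tendsto_assocFun hM hlc hm).eventually_ge_atTop 1))
  set c := max c₀ (quotients M P)
  have hpos : ∀ t, c < t → 1 < t ∧ 1 ≤ assocFun M t := fun t ht =>
    hc₀ t ((le_max_left _ _).trans ht.le)
  refine ⟨c, l, hl, ⟨(quotients_pos hM P).le.trans (le_max_right _ _), ?_, fun t ht => ?_, hd, ?_⟩⟩
  · exact isPiecewiseC1_dFun hM hlc hm (le_max_right _ _) hP fun t ht =>
      ⟨(hpos t ht).1, one_pos.trans_le (hpos t ht).2⟩
  · exact div_nonneg (Real.log_nonneg (hpos t ht).2) (Real.log_nonneg (hpos t ht).1.le)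
  · have h₁ := (hn.inv₀ (by positivity)).sub hd
    simp only [one_div, inv_inv, sub_self] at h₁
    refine (h₁.mono_left inf_le_left).congr' ?_
    rw [EventuallyEq, eventually_inf_principal]
    filter_upwards [eventually_gt_atTop c] with t ht hdiff
    have hn := lt_quotientCount hM hlc hm ((le_max_right c₀ (quotients M P)).trans_lt ht)
    obtain ⟨k, hk⟩ := Nat.exists_eq_succ_of_ne_zero (Nat.ne_zero_of_lt hn)
    have ht₀ := hpos t ht
    have ht₁ : 0 < t := by linarith
    have h₂ := le_quotients_quotientCount hm t
    rw [hk] at h₂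
    have h₃ : quotients M k < t := quotients_lt_of_lt_quotientCount (by lia)
    -- At a point of differentiability the derivative is the left one, so quotients need not be
    -- excluded separately.
    have h₄ := (uniqueDiffWithinAt_Iio t).eq_deriv _
      (hasDerivWithinAt_dFun_left hM hlc h₃ h₂ ht₀.1 (by linarith)) hdiff.hasDerivAt.hasDerivWithinAt
    have hl₀ := Real.log_pos ht₀.1
    have hE := assocFun_eq_quotientCount hM hlc hm ht₁
    rw [← h₄, dBranchDeriv, ← dFun_eqOn hM hlc k ⟨h₃.le, h₂⟩]
    rw [hk, Nat.succ_eq_add_one] at hE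
    rw [← hE, hk, Nat.succ_eq_add_one]
    field_simp

/-! ### Sequences with prescribed quotients, and comparison with f. -/

/-- The sequence with quotients `exp (a p)`. -/
def seqOfLogQuotients (a : ℕ → ℝ) (p : ℕ) : ℝ :=
  Real.exp (∑ j ∈ Finset.range p, a j)

theorem isNormalizedPosSeq_seqOfLogQuotients (a : ℕ → ℝ) :
    IsNormalizedPosSeq (seqOfLogQuotients a) :=
  ⟨fun _ => Real.exp_pos _, by simp [seqOfLogQuotients]⟩

theorem quotients_seqOfLogQuotients (a : ℕ → ℝ) (p : ℕ) :
    quotients (seqOfLogQuotients a) p = Real.exp (a p) := by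
  rw [quotients, seqOfLogQuotients, seqOfLogQuotients, ← Real.exp_sub, Finset.sum_range_succ,
    add_sub_cancel_left]

theorem isLogConvex_seqOfLogQuotients {a : ℕ → ℝ} (ha : Monotone a) :
    IsLogConvex (seqOfLogQuotients a) := by
  intro p
  simp only [seqOfLogQuotients, Finset.sum_range_succ, ← Real.exp_add, ← Real.exp_nat_mul]
  have := ha p.le_succ
  refine Real.exp_le_exp.2 ?_
  push_cast
  simp only [Nat.succ_eq_add_one] at this
  linarith

/-- If `f` takes the value `log (p + 1)` at `log m_p`, then `exp ∘ f ∘ log` is comparable with the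
associated function. -/
theorem exists_abs_log_assocFun_sub_le {M : ℕ → ℝ} (hM : IsNormalizedPosSeq M)
    (hlc : IsLogConvex M) (hm : Tendsto (quotients M) atTop atTop) {f : ℝ → ℝ} {l : ℝ}
    (hf : HasSlopeAtTop f l) (hl : 0 < l)
    (hval : ∀ᶠ p in atTop, f (Real.log (quotients M p)) = Real.log ((p : ℝ) + 1))
    (hn : Tendsto (fun t => assocFun M t / quotientCount M t) atTop (𝓝 (1 / l))) :
    ∃ K, ∀ᶠ t in atTop, |Real.log (assocFun M t) - f (Real.log t)| ≤ K := by
  -- Tolerance l makes f nondecreasing beyond x₀, whence log n ≤ f(log t) ≤ log(n+1) for n = n(t).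
  obtain ⟨x₀, hx₀⟩ := hf l hl
  have hc := tendsto_quotientCount hM hlc hm
  have hc' : Tendsto (fun t => quotientCount M t - 1) atTop atTop :=
    (tendsto_sub_atTop_nat 1).comp hc
  have hloga : Tendsto (fun p => Real.log (quotients M p)) atTop atTop :=
    Real.tendsto_log_atTop.comp hm
  have h₁ : Tendsto (fun t => Real.log (assocFun M t / quotientCount M t)) atTop
      (𝓝 (Real.log (1 / l))) := hn.log (by positivity)
  have h₂ := h₁.eventually (Metric.closedBall_mem_nhds _ one_pos)
  refine ⟨|Real.log (1 / l)| + 2, ?_⟩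
  filter_upwards [h₂, hc.eventually hval, hc'.eventually hval, hc.eventually_ge_atTop 1,
    eventually_gt_atTop 0, (tendsto_assocFun hM hlc hm).eventually_gt_atTop 0,
    hc'.eventually (hloga.eventually_ge_atTop x₀)] with t h₂ h₃ h₄ h₅ ht hG h₆
  have h₇ := Real.log_le_log ht (le_quotients_quotientCount hm t)
  have h₈ := Real.log_le_log (quotients_pos hM _)
    (quotients_lt_of_lt_quotientCount (M := M) (t := t) (Nat.sub_lt h₅ one_pos)).le
  generalize quotientCount M t = n at *
  have hn0 : (1 : ℝ) ≤ n := by exact_mod_cast h₅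
  rw [Nat.cast_sub h₅, Nat.cast_one, sub_add_cancel] at h₄
  have h₉ := (abs_le.1 (hx₀ _ _ h₆ h₈)).1
  have h₁₀ := (abs_le.1 (hx₀ _ _ (h₆.trans h₈) h₇)).1
  rw [h₄] at h₉
  rw [h₃] at h₁₀
  have h₁₁ : Real.log ((n : ℝ) + 1) ≤ Real.log n + 1 := by
    have e : (n : ℝ) + 1 = n * (1 + 1 / n) := by field_simp
    have h' : 0 < 1 / (n : ℝ) := by positivity
    have h'' : 1 / (n : ℝ) ≤ 1 := by rw [div_le_one (by linarith)]; exact hn0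
    have := Real.log_le_sub_one_of_pos (show 0 < 1 + 1 / (n : ℝ) by linarith)
    rw [e, Real.log_mul (by linarith) (by linarith)]
    linarith
  rw [Real.dist_eq, Real.log_div hG.ne' (by linarith)] at h₂
  have h₁₂ := abs_le.1 h₂
  have h₁₃ := abs_le.1 (le_refl |Real.log (1 / l)|)
  rw [abs_le]
  constructor <;> linarith [h₁₂.1, h₁₂.2, h₁₃.1, h₁₃.2]

/-- Two positive functions which are, up to bounded factors, the exponential of a function with
positive slope at infinity, are comparable after a dilation of the variable. -/
theorem exists_assocFun_le_of_log_bounded {A B : ℕ → ℝ} (hA : IsNormalizedPosSeq A)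
    (hB : IsNormalizedPosSeq B) (hlcA : IsLogConvex A) (hlcB : IsLogConvex B)
    (hmA : Tendsto (quotients A) atTop atTop) (hmB : Tendsto (quotients B) atTop atTop)
    {f : ℝ → ℝ} {l : ℝ} (hf : HasSlopeAtTop f l) (hl : 0 < l) {K K' : ℝ}
    (hKA : ∀ᶠ t in atTop, |Real.log (assocFun A t) - f (Real.log t)| ≤ K)
    (hKB : ∀ᶠ t in atTop, |Real.log (assocFun B t) - f (Real.log t)| ≤ K') :
    ∃ C : ℝ, 0 < C ∧ ∀ᶠ t in atTop, assocFun A t ≤ assocFun B (C * t) := by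
  obtain ⟨c, -, hc⟩ := hf.exists_gap hl (K + K')
  have hC := Real.exp_pos c
  have hmul : Tendsto (fun t => Real.exp c * t) atTop atTop := tendsto_id.const_mul_atTop hC
  refine ⟨Real.exp c, hC, ?_⟩
  filter_upwards [hKA, hmul.eventually hKB, Real.tendsto_log_atTop.eventually hc,
    eventually_gt_atTop 0, (tendsto_assocFun hA hlcA hmA).eventually_gt_atTop 0,
    hmul.eventually ((tendsto_assocFun hB hlcB hmB).eventually_gt_atTop 0)]
    with t h₁ h₂ h₃ ht h₄ h₅
  refine (Real.log_le_log_iff h₄ h₅).1 ?_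
  rw [Real.log_mul hC.ne' ht.ne', Real.log_exp, add_comm c] at h₂
  linarith [(abs_le.1 h₁).2, (abs_le.1 h₂).1]

/-! ### The two implications. -/

theorem admits_of_seqEquiv {M L : ℕ → ℝ} (hM : IsNormalizedPosSeq M) (hlc : IsLogConvex M)
    (hm : Tendsto (quotients M) atTop atTop) (hL : IsNormalizedPosSeq L) (hlcL : IsLogConvex L)
    (hmL : Tendsto (quotients L) atTop atTop) (he : SeqEquiv L M)
    (hd : IsNonzeroProximateOrder (dFun L)) : AdmitsNonzeroProximateOrder M := by
  refine ⟨dFun L, hd, ?_⟩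
  obtain ⟨C, D, hC, hD, hCD⟩ := he
  obtain ⟨c, l, hl, hρ⟩ := hd
  have hf := hρ.hasSlopeAtTop
  obtain ⟨K₁, hK₁⟩ := hf.exists_bound (Real.log C)
  obtain ⟨K₂, hK₂⟩ := hf.exists_bound (Real.log D)
  have hbound : ∀ {E K : ℝ}, 0 < E →
      (∀ᶠ x in atTop, |(x + Real.log E) * dFun L (Real.exp (x + Real.log E)) -
        x * dFun L (Real.exp x)| ≤ K) →
      ∀ᶠ t in atTop, |Real.log (assocFun L (E * t)) - Real.log (assocFun L t)| ≤ K := by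
    intro E K hE h
    have hmul : Tendsto (fun t => E * t) atTop atTop := tendsto_id.const_mul_atTop hE
    filter_upwards [Real.tendsto_log_atTop.eventually h, eventually_gt_atTop 1,
      hmul.eventually_gt_atTop 1] with t h₁ h₂ h₃
    have ht : 0 < t := by linarith
    rwa [add_comm, ← Real.log_mul hE.ne' ht.ne', Real.exp_log ht, Real.exp_log (mul_pos hE ht),
      dFun_mul_log L h₂, dFun_mul_log L h₃] at h₁
  have hmulD : Tendsto (fun t => D * t) atTop atTop := tendsto_id.const_mul_atTop hD
  -- From M_L(Dt) ≤ M_M(t) ≤ M_L(Ct): the dilation by C costs at most K₁ in the logarithm, the one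
  -- by D at most K₂.
  refine ⟨-K₁, K₂, ?_⟩
  filter_upwards [hbound hC hK₁, hbound hD hK₂, eventually_gt_atTop 1,
    (tendsto_assocFun hM hlc hm).eventually_gt_atTop 0,
    hmulD.eventually ((tendsto_assocFun hL hlcL hmL).eventually_gt_atTop 0)] with t h₁ h₂ ht h₃ h₄
  have ht₀ : 0 < t := by linarith
  rw [mul_sub, dFun_mul_log L ht, dFun_mul_log M ht]
  have h₅ := Real.log_le_log h₃
    (assocFun_le_of_le_pow_mul hL hM hlcL hmL hC (fun p => (hCD p).2) ht₀)
  have hDM : ∀ p, M p ≤ D⁻¹ ^ p * L p := fun p => by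
    rw [inv_pow, le_inv_mul_iff₀ (pow_pos hD p)]
    exact (hCD p).1
  have h₆ := assocFun_le_of_le_pow_mul hM hL hlc hm (inv_pos.2 hD) hDM (mul_pos hD ht₀)
  rw [inv_mul_cancel_left₀ hD.ne'] at h₆
  have h₇ := Real.log_le_log h₄ h₆
  constructor <;> linarith [(abs_le.1 h₁).2, (abs_le.1 h₂).1]

theorem exists_seqEquiv_of_admits {M : ℕ → ℝ} (hM : IsNormalizedPosSeq M) (hlc : IsLogConvex M)
    (hm : Tendsto (quotients M) atTop atTop) (h : AdmitsNonzeroProximateOrder M) :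
    ∃ L : ℕ → ℝ, IsNormalizedPosSeq L ∧ IsLogConvex L ∧
      Tendsto (quotients L) atTop atTop ∧ SeqEquiv L M ∧ IsNonzeroProximateOrder (dFun L) := by
  obtain ⟨ρ, ⟨c, l, hl, hρ⟩, A, B, hAB⟩ := h
  have hf := hρ.hasSlopeAtTop
  obtain ⟨a, hamono, hatop, haval, halt, hagap⟩ := hf.exists_seq hl
  set f : ℝ → ℝ := fun x => x * ρ (Real.exp x) with hfdef
  set L := seqOfLogQuotients a with hLdef
  have hq : ∀ p, quotients L p = Real.exp (a p) := quotients_seqOfLogQuotients a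
  have hlogq : ∀ p, Real.log (quotients L p) = a p := fun p => by rw [hq, Real.log_exp]
  have hL : IsNormalizedPosSeq L := isNormalizedPosSeq_seqOfLogQuotients a
  have hlcL : IsLogConvex L := isLogConvex_seqOfLogQuotients hamono
  have hmL : Tendsto (quotients L) atTop atTop := by
    rw [funext hq]
    exact Real.tendsto_exp_atTop.comp hatop
  have hn := tendsto_assocFun_div_quotientCount hL hlcL hmL (κ := 1 / l)
    (by simpa only [hlogq] using hagap)
  obtain ⟨K, hK⟩ := exists_abs_log_assocFun_sub_le hL hlcL hmL hf hl
    (haval.mono fun p hp => by rwa [hlogq]) hn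
  have hflog : ∀ t, 0 < t → f (Real.log t) = Real.log t * ρ t := fun t ht => by
    simp only [hfdef, Real.exp_log ht]
  have hKM : ∀ᶠ t in atTop, |Real.log (assocFun M t) - f (Real.log t)| ≤ |A| + |B| := by
    filter_upwards [hAB, eventually_gt_atTop 1] with t ht ht'
    rw [mul_sub, dFun_mul_log M ht'] at ht
    rw [hflog t (by linarith), abs_le]
    constructor <;>
      linarith [ht.1, ht.2, neg_abs_le A, le_abs_self B, abs_nonneg A, abs_nonneg B]
  have hd : Tendsto (dFun L) atTop (𝓝 l) := by
    -- A bounded difference of log M_L(t) and log t · ρ(t) becomes O(1/log t) after division by log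
    -- t.
    have h₀ : Tendsto (fun t => dFun L t - ρ t) atTop (𝓝 0) := by
      refine squeeze_zero_norm' ?_ (Real.tendsto_log_atTop.const_div_atTop K)
      filter_upwards [hK, eventually_gt_atTop 1] with t ht ht'
      have hlog := Real.log_pos ht'
      rw [hflog t (by linarith), ← dFun_mul_log L ht', ← mul_sub, abs_mul, abs_of_pos hlog] at ht
      rwa [Real.norm_eq_abs, le_div_iff₀' hlog]
    simpa using h₀.add hρ.tendsto
  obtain ⟨C₁, hC₁, h₁⟩ := exists_assocFun_le_of_log_bounded hM hL hlc hlcL hm hmL hf hl hKM hK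
  obtain ⟨C₂, hC₂, h₂⟩ := exists_assocFun_le_of_log_bounded hL hM hlcL hlc hmL hm hf hl hK hKM
  obtain ⟨K₁, hK₁, h₃⟩ := exists_le_pow_mul_of_assocFun_le hM hL hlc hlcL hm hmL hC₁ h₁
  obtain ⟨K₂, hK₂, h₄⟩ := exists_le_pow_mul_of_assocFun_le hL hM hlcL hlc hmL hm hC₂ h₂
  refine ⟨L, hL, hlcL, hmL, ⟨K₁, K₂⁻¹, hK₁, inv_pos.2 hK₂, fun p => ⟨?_, h₃ p⟩⟩,
    isNonzeroProximateOrder_dFun hL hlcL hmL hl ?_ hd hn⟩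
  · rw [inv_pow, inv_mul_le_iff₀ (pow_pos hK₂ p)]
    exact h₄ p
  · simpa only [hq, Real.exp_lt_exp] using halt

end

theorem theorem4p12 (M : ℕ → ℝ) (hM : IsNormalizedPosSeq M) (hlc : IsLogConvex M)
    (hm : Tendsto (quotients M) atTop atTop) :
    (∃ L : ℕ → ℝ, IsNormalizedPosSeq L ∧ IsLogConvex L ∧
        Tendsto (quotients L) atTop atTop ∧ SeqEquiv L M ∧
        IsNonzeroProximateOrder (dFun L)) ↔
      AdmitsNonzeroProximateOrder M :=
  ⟨fun ⟨_, hL, hlcL, hmL, he, hd⟩ => admits_of_seqEquiv hM hlc hm hL hlcL hmL he hd,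
    exists_seqEquiv_of_admits hM hlc hm⟩
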